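/- For a set $X$ let $L^+X=\coprod_{n>0}X^n$ be the set of non-empty lists $[x_1,\dots,x_n]$ of elements of $X$, and for $f\colon X\to Y$ let $L^+f[x_1,\dots,x_n]=[f(x_1),\dots,f(x_n)]$. The endofunctor $L^+$ of $\mathbf{Set}$ is a monad $\mathbb L^+$ with multiplication $\mu_X\colon L^+L^+X\to L^+X$ the concatenation of a list of lists and unit $\eta_X(x)=[x]$, and a comonad $\mathbb C$ with comultiplication $\Delta_X[x_1,\dots,x_n]=[[x_1,\dots,x_n],[x_2,\dots,x_n],\dots,[x_n]]$ and counit $\varepsilon_X[x_1,\dots,x_n]=x_1$. The mixed distributive law $\theta\colon \mathbb L^+\mathbb C\Rightarrow\mathbb C\mathbb L^+$ sends a list of lists $[[x_{1,1},\dots,x_{1,n_1}],\dots,[x_{m,1},\dots,x_{m,n_m}]]$ to the list of all lists $[x_{i,j},x_{i+1,1},x_{i+2,1},\dots,x_{m,1}]$ with $1\le i\le m$ and $1\le j\le n_i$, the pairs $(i,j)$ being taken in lexicographic order. With these data $L^+$ is a bimonad (in the sense of Mesablishvili and Wisbauer), the non-empty list bimonad. Let $\mathbf{Sgp}=\mathbf{Set}^{\mathbb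 L^+}$ be the Eilenberg--Moore category of the monad $\mathbb L^+$ (which is isomorphic to the category of semigroups), and let $\mathbb C^\theta$ be the lift of the comonad $\mathbb C$ to $\mathbf{Sgp}$, given by $C^\theta(X,\alpha)=(L^+X,\,L^+(\alpha)\circ\theta_X)$ and $C^\theta(f)=L^+(f)$, with $\Delta^{\mathbb C^\theta}_{(X,\alpha)}=\Delta_X$ and $\varepsilon^{\mathbb C^\theta}_{(X,\alpha)}=\varepsilon_X$. Let $\mathbf{Sgp}_{\mathbb C^\theta}$ be the category of $\mathbb C^\theta$-coalgebras, and let $$K\colon\mathbf{Set}\to\mathbf{Sgp}_{\mathbb C^\theta},\qquad K(X)=((L^+X,\mu_X),\Delta_X),\qquad K(f)=L^+(f).$$ Then $K$ is not an equivalence of categories. Consequently the hypotheses of the conjugate classification, namely that $\theta$ is invertible and that the comparison functor $K$ is an equivalence, are not both satisfied by the non-empty list bimonad. -/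

import Mathlib

open CategoryTheory

universe v u

/-- A mixed distributive law `θ : B C ⇒ C B` of a monad `B` over a comonad `C`
(note that `F ⋙ G` is the composite "first `F`, then `G`"): `(C, θ)` is a lax endomorphism of the
monad `B` and `(B, θ)` is a colax endomorphism of the comonad `C`. -/
structure MixedDistributiveLaw {A : Type u} [Category.{v} A] (B : Monad A) (C : Comonad A) where
  θ : C.toFunctor ⋙ B.toFunctor ⟶ B.toFunctor ⋙ C.toFunctor
  mul : ∀ X : A, B.μ.app (C.obj X) ≫ θ.app X =
    B.map (θ.app X) ≫ θ.app (B.obj X) ≫ C.map (B.μ.app X)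
  unit : ∀ X : A, B.η.app (C.obj X) ≫ θ.app X = C.map (B.η.app X)
  comul : ∀ X : A, θ.app X ≫ C.δ.app (B.obj X) =
    B.map (C.δ.app X) ≫ θ.app (C.obj X) ≫ C.map (θ.app X)
  counit : ∀ X : A, θ.app X ≫ C.ε.app (B.obj X) = B.map (C.ε.app X)

namespace MixedDistributiveLaw

variable {A : Type u} [Category.{v} A] {B : Monad A} {C : Comonad A}

/-- The functor `C^θ` on the Eilenberg–Moore category of `B`:
`C^θ (X, α) = (C X, C α ∘ θ_X)` and `C^θ f = C f`. -/
def liftFunctor (t : MixedDistributiveLaw B C) : B.Algebra ⥤ B.Algebra where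
  obj M :=
    { A := C.obj M.A
      a := t.θ.app M.A ≫ C.map M.a
      unit := by
        rw [← Category.assoc, t.unit, ← C.map_comp, M.unit]
        exact C.map_id _
      assoc := by
        have h := t.θ.naturality M.a
        simp only [Functor.comp_map] at h
        rw [← Category.assoc, t.mul, Functor.map_comp, Category.assoc, Category.assoc,
          Category.assoc, ← C.map_comp, M.assoc, C.map_comp, reassoc_of% h] }
  map {M N} f :=
    { f := C.map f.f
      h := by
        have h := t.θ.naturality f.f
        simp only [Functor.comp_map] at h
        change B.map (C.map f.f) ≫ t.θ.app N.A ≫ C.map N.a =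
          (t.θ.app M.A ≫ C.map M.a) ≫ C.map f.f
        rw [reassoc_of% h, ← C.map_comp, f.h, C.map_comp, Category.assoc] }
  map_id M := by ext; exact C.map_id _
  map_comp f g := by ext; exact C.map_comp _ _

/-- The lift `C^θ` of the comonad `C` to the Eilenberg–Moore category of the monad `B`, whose
comultiplication and counit at `(X, α)` are those of `C` at `X`. -/
def lift (t : MixedDistributiveLaw B C) : Comonad B.Algebra where
  toFunctor := t.liftFunctor
  ε :=
    { app := fun M =>
        { f := C.ε.app M.A
          h := by
            have h := C.ε.naturality M.a
            simp only [Functor.id_map] at h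
            change B.map (C.ε.app M.A) ≫ M.a = (t.θ.app M.A ≫ C.map M.a) ≫ C.ε.app M.A
            rw [Category.assoc, h, ← t.counit, Category.assoc] }
      naturality := fun M N f => by ext; exact C.ε.naturality f.f }
  δ :=
    { app := fun M =>
        { f := C.δ.app M.A
          h := by
            have h := C.δ.naturality M.a
            have h' := t.θ.naturality M.a
            simp only [Functor.comp_map] at h h'
            change B.map (C.δ.app M.A) ≫ t.θ.app (C.obj M.A) ≫ C.map (t.θ.app M.A ≫ C.map M.a) =
              (t.θ.app M.A ≫ C.map M.a) ≫ C.δ.app M.A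
            rw [Category.assoc, h, ← Category.assoc (t.θ.app M.A), t.comul, C.map_comp]
            simp only [Category.assoc] }
      naturality := fun M N f => by ext; exact C.δ.naturality f.f }
  coassoc M := by ext; exact C.coassoc M.A
  left_counit M := by ext; exact C.left_counit M.A
  right_counit M := by ext; exact C.right_counit M.A

end MixedDistributiveLaw

/-- A bimonad in the sense of Mesablishvili and Wisbauer: a monad and a comonad with the same
underlying endofunctor, together with a compatible mixed distributive law. -/
structure Bimonad (A : Type u) [Category.{v} A] extends CategoryTheory.Monad A,
    CategoryTheory.Comonad A where
  law : MixedDistributiveLaw toMonad toComonad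
  counit_mul : ∀ X : A, μ.app X ≫ ε.app X = ε.app (toFunctor.obj X) ≫ ε.app X
  unit_comul : ∀ X : A, η.app X ≫ δ.app X = η.app X ≫ η.app (toFunctor.obj X)
  unit_counit : ∀ X : A, η.app X ≫ ε.app X = 𝟙 X
  mul_comul : ∀ X : A, μ.app X ≫ δ.app X =
    toFunctor.map (δ.app X) ≫ law.θ.app (toFunctor.obj X) ≫ toFunctor.map (μ.app X)

namespace Bimonad

variable {A : Type u} [Category.{v} A]

/-- The category `(A^B)_{C^θ}` of entwined coalgebras: coalgebras over the lifted comonad `C^θ` on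
the Eilenberg–Moore category of the monad `B`. -/
abbrev EntwinedCoalgebra (B : Bimonad A) : Type max u v := B.law.lift.Coalgebra

/-- The comparison functor `K : A ⥤ (A^B)_{C^θ}`, `K X = (F X, Δ_X) = ((B X, μ_X), Δ_X)` and
`K f = F f`, where `F` is the free `B`-algebra functor. -/
def comparison (B : Bimonad A) : A ⥤ B.EntwinedCoalgebra where
  obj X :=
    { A := B.toMonad.free.obj X
      a :=
        { f := B.δ.app X
          h := by
            change B.map (B.δ.app X) ≫ B.law.θ.app (B.obj X) ≫ B.map (B.μ.app X) =
              B.μ.app X ≫ B.δ.app X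
            exact (B.mul_comul X).symm }
      counit := by ext; exact B.left_counit X
      coassoc := by ext; exact (B.coassoc X).symm }
  map f :=
    { f := B.toMonad.free.map f
      h := by ext; exact (B.δ.naturality f).symm }
  map_id X := by ext; exact B.map_id X
  map_comp f g := by ext; exact B.map_comp f g

/-- The hypotheses under which the conjugate classification (of left `χ`-coalgebras on a functor
`N` by opcoalgebras on `N F` over the comonad on `A` conjugate to `T^θ` along `K`) applies to the
bimonad: `θ` is invertible and `K` is an equivalence. -/
def ConjugateClassificationApplies (B : Bimonad A) : Prop :=
  IsIso B.law.θ ∧ B.comparison.IsEquivalence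

end Bimonad

/-- Non-empty lists: `single x` is `[x]` and `cons x [x₁, …, xₙ]` is `[x, x₁, …, xₙ]`. -/
inductive NEList (X : Type u) : Type u
  | single (x : X) : NEList X
  | cons (x : X) (l : NEList X) : NEList X

namespace NEList

variable {X Y Z : Type u}

/-- Concatenation of two lists. -/
def append : NEList X → NEList X → NEList X
  | single x, m => cons x m
  | cons x l, m => cons x (append l m)

/-- `[x₁, …, xₙ] ↦ [f x₁, …, f xₙ]`. -/
def map (f : X → Y) : NEList X → NEList Y
  | single x => single (f x)
  | cons x l => cons (f x) (map f l)

/-- Concatenation of a list of lists. -/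
def flatten : NEList (NEList X) → NEList X
  | single l => l
  | cons l L => append l (flatten L)

/-- `[x₁, …, xₙ] ↦ x₁`. -/
def head : NEList X → X
  | single x => x
  | cons x _ => x

/-- `[x₁, …, xₙ] ↦ [[x₁, …, xₙ], [x₂, …, xₙ], …, [xₙ]]`. -/
def tails : NEList X → NEList (NEList X)
  | single x => single (single x)
  | cons x l => cons (cons x l) (tails l)

/-- The list of lists `[[x₁₁, …], …, [xₘ₁, …]]` is sent to the list of all
`[xᵢⱼ, xᵢ₊₁,₁, xᵢ₊₂,₁, …, xₘ₁]`, with the pairs `(i, j)` in lexicographic order. -/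
def theta : NEList (NEList X) → NEList (NEList X)
  | single l => map single l
  | cons l L => append (map (fun x => cons x (map head L)) l) (theta L)

theorem append_assoc (l m k : NEList X) : append (append l m) k = append l (append m k) := by
  induction l with
  | single x => rfl
  | cons x l ih => simp only [append, ih]

theorem map_append (f : X → Y) (l m : NEList X) :
    map f (append l m) = append (map f l) (map f m) := by
  induction l with
  | single x => rfl
  | cons x l ih => simp only [append, map, ih]

theorem map_id' (l : NEList X) : map (fun x => x) l = l := by
  induction l with
  | single x => rfl
  | cons x l ih => simp only [map, ih]

theorem map_map (g : Y → Z) (f : X → Y) (l : NEList X) :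
    map g (map f l) = map (fun x => g (f x)) l := by
  induction l with
  | single x => rfl
  | cons x l ih => simp only [map, ih]

theorem head_map (f : X → Y) (l : NEList X) : head (map f l) = f (head l) := by
  cases l <;> rfl

theorem head_append (l m : NEList X) : head (append l m) = head l := by
  cases l <;> rfl

theorem head_flatten (L : NEList (NEList X)) : head (flatten L) = head (head L) := by
  cases L with
  | single l => rfl
  | cons l L => exact head_append _ _

theorem head_tails (l : NEList X) : head (tails l) = l := by
  cases l <;> rfl

theorem flatten_append (L M : NEList (NEList X)) :
    flatten (append L M) = append (flatten L) (flatten M) := by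
  induction L with
  | single x => rfl
  | cons x l ih => simp only [append, flatten, ih, append_assoc]

theorem map_flatten (f : X → Y) (L : NEList (NEList X)) :
    map f (flatten L) = flatten (map (map f) L) := by
  induction L with
  | single l => rfl
  | cons l L ih => simp only [map, flatten, map_append, ih]

theorem flatten_flatten (L : NEList (NEList (NEList X))) :
    flatten (map flatten L) = flatten (flatten L) := by
  induction L with
  | single l => rfl
  | cons l L ih => simp only [map, flatten, flatten_append, ih]

theorem flatten_map_single (l : NEList X) : flatten (map single l) = l := by
  induction l with
  | single x => rfl
  | cons x l ih => simp only [map, flatten, append, ih]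

theorem map_tails (f : X → Y) (l : NEList X) : tails (map f l) = map (map f) (tails l) := by
  induction l with
  | single x => rfl
  | cons x l ih => simp only [map, tails, ih]

theorem tails_tails (l : NEList X) : map tails (tails l) = tails (tails l) := by
  induction l with
  | single x => rfl
  | cons x l ih => simp only [map, tails, ih]

theorem map_head_tails (l : NEList X) : map head (tails l) = l := by
  induction l with
  | single x => rfl
  | cons x l ih => simp only [map, tails, head, ih]

theorem map_theta (f : X → Y) (L : NEList (NEList X)) :
    theta (map (map f) L) = map (map f) (theta L) := by
  induction L with
  | single l => simp only [map, theta, map_map]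
  | cons l L ih => simp only [map, theta, map_append, map_map, head_map, ih]

theorem head_theta (L : NEList (NEList X)) : head (theta L) = map head L := by
  cases L with
  | single l => simp only [theta, map, head_map]
  | cons l L => simp only [theta, map, head_append, head_map]

theorem tails_append (l m : NEList X) :
    tails (append l m) = append (map (fun t => append t m) (tails l)) (tails m) := by
  induction l with
  | single x => rfl
  | cons x l ih => simp only [append, tails, map, ih]

theorem tails_flatten (L : NEList (NEList X)) :
    tails (flatten L) = map flatten (theta (map tails L)) := by
  induction L with
  | single l => simp only [flatten, map, theta, map_map, map_id']
  | cons l L ih =>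
    simp only [flatten, map, theta, map_append, map_map, head_tails, map_id', tails_append, ih]

theorem tails_theta (L : NEList (NEList X)) :
    tails (theta L) = map theta (theta (map tails L)) := by
  induction L with
  | single l => simp only [map, theta, map_map, map_tails]
  | cons l L ih =>
    simp only [map, theta, map_append, map_map, head_tails, map_id', tails_append, map_tails, ih]

theorem theta_append (L M : NEList (NEList X)) :
    theta (append L M) =
      append (map (fun t => append t (map head M)) (theta L)) (theta M) := by
  induction L with
  | single l => simp only [append, theta, map_map]
  | cons l L ih => simp only [append, theta, map_append, map_map, ih, append_assoc]

theorem theta_flatten (L : NEList (NEList (NEList X))) :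
    theta (flatten L) = map flatten (theta (map theta L)) := by
  induction L with
  | single l => simp only [flatten, map, theta, map_map, map_id']
  | cons l L ih =>
    simp only [flatten, map, theta, map_append, map_map, theta_append, ih, map_flatten,
      head_theta]

/-- The endofunctor `L⁺` on sets. -/
def functor : Type u ⥤ Type u where
  obj X := NEList X
  map f := ↾(map f)
  map_id X := by ext l; exact map_id' l
  map_comp f g := by ext l; exact (map_map g f l).symm

/-- The non-empty list monad. -/
def monad : CategoryTheory.Monad (Type u) where
  toFunctor := functor
  η := { app := fun X => ↾(single : X → NEList X), naturality := fun X Y f => rfl }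
  μ :=
    { app := fun X => ↾(flatten : NEList (NEList X) → NEList X)
      naturality := fun X Y f => by ext L; exact (map_flatten f L).symm }
  assoc X := by ext L; exact flatten_flatten L
  left_unit X := rfl
  right_unit X := by ext l; exact flatten_map_single l

/-- The non-empty list comonad. -/
def comonad : CategoryTheory.Comonad (Type u) where
  toFunctor := functor
  ε :=
    { app := fun X => ↾(head : NEList X → X)
      naturality := fun X Y f => by ext l; exact head_map f l }
  δ :=
    { app := fun X => ↾(tails : NEList X → NEList (NEList X))
      naturality := fun X Y f => by ext l; exact map_tails f l }
  coassoc X := by ext l; exact tails_tails l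
  left_counit X := by ext l; exact head_tails l
  right_counit X := by ext l; exact map_head_tails l

/-- The mixed distributive law of the non-empty list bimonad. -/
def law : MixedDistributiveLaw monad.{u} comonad.{u} where
  θ :=
    { app := fun X => ↾(theta : NEList (NEList X) → NEList (NEList X))
      naturality := fun X Y f => by ext L; exact map_theta f L }
  mul X := by ext L; exact theta_flatten L
  unit X := rfl
  comul X := by ext L; exact tails_theta L
  counit X := by ext L; exact head_theta L

/-- The non-empty list bimonad `L⁺` on the category of sets. -/
def bimonad : Bimonad (Type u) where
  toMonad := monad
  ε := comonad.ε
  δ := comonad.δ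
  coassoc := comonad.coassoc
  left_counit := comonad.left_counit
  right_counit := comonad.right_counit
  law := law
  counit_mul X := by ext L; exact head_flatten L
  unit_comul X := rfl
  unit_counit X := rfl
  mul_comul X := by ext L; exact tails_flatten L

end NEList

/-!
`K X` is the free semigroup on `X`, which is right cancellative, and right cancellation passes to
everything isomorphic to `K X`. A semigroup `S` is made into an entwined coalgebra by arranging it
as a forest of finite depth, `p s` being the path from `s` down to its root, in such a way that
`p (s * t)` is `p s` multiplied by `t` on the right, followed by `p t`. In particular `r * t` sits
immediately above `t` for every root `r`. Nothing forces `r` to be recovered from `r * t`: in the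
forest `ℕ × α` of towers, `r * t` is the only element immediately above `t`, so as soon as there
are two roots right cancellation fails.
-/

namespace NEList

section Cancellation

variable {X : Type u}

theorem sizeOf_lt_sizeOf_append (l m : NEList X) : sizeOf m < sizeOf (append l m) := by
  induction l <;> simp only [append, cons.sizeOf_spec] <;> omega

theorem append_ne_right (l m : NEList X) : append l m ≠ m := fun h =>
  (sizeOf_lt_sizeOf_append l m).ne' (congrArg sizeOf h)

theorem append_right_cancel {l m k : NEList X} (h : append l k = append m k) : l = m := by
  induction l generalizing m with
  | single x =>
    cases m with
    | single y => rw [(cons.inj h).1]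
    | cons y m => exact absurd (cons.inj h).2.symm (append_ne_right m k)
  | cons x l ih =>
    cases m with
    | single y => exact absurd (cons.inj h).2 (append_ne_right l k)
    | cons y m => rw [(cons.inj h).1, ih (cons.inj h).2]

end Cancellation

section Algebra

/-- The multiplication of the semigroup that corresponds to an algebra over the non-empty list
monad. -/
def algebraMul (M : monad.{u}.Algebra) (s t : M.A) : M.A :=
  M.a (cons s (single t) : NEList M.A)

theorem map_algebraMul {M N : monad.{u}.Algebra} (g : M ⟶ N) (s t : M.A) :
    g.f (algebraMul M s t) = algebraMul N (g.f s) (g.f t) :=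
  (ConcreteCategory.congr_hom g.h (cons s (single t) : NEList M.A)).symm

theorem algebraMul_free_right_cancel {X : Type u} {l m k : (monad.free.obj X).A}
    (h : algebraMul (monad.free.obj X) l k = algebraMul (monad.free.obj X) m k) : l = m :=
  append_right_cancel h

theorem algebraMul_right_cancel_of_injective {M : monad.{u}.Algebra} {X : Type u}
    (g : M ⟶ monad.free.obj X) (hg : Function.Injective g.f) {r s t : M.A}
    (h : algebraMul M s r = algebraMul M t r) : s = t :=
  hg <| algebraMul_free_right_cancel (k := g.f r) <| by
    rw [← map_algebraMul, ← map_algebraMul, h]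

theorem algebraMul_right_cancel_of_mem_essImage {M : bimonad.{u}.EntwinedCoalgebra}
    (hM : bimonad.comparison.essImage M) {r s t : M.A.A}
    (h : algebraMul M.A s r = algebraMul M.A t r) : s = t := by
  obtain ⟨X, ⟨i⟩⟩ := hM
  have inv_injective : Function.Injective i.inv.f.f :=
    ((bimonad.law.lift.forget ⋙ monad.forget).mapIso i).symm.toEquiv.injective
  exact algebraMul_right_cancel_of_injective i.inv.f inv_injective h

end Algebra

section Semigroup

variable {S : Type u}

/-- The product `x₁ * ⋯ * xₙ` of a non-empty list, bracketed to the right. -/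
def prod [Mul S] : NEList S → S
  | single s => s
  | cons s l => s * prod l

theorem prod_append [Semigroup S] (l m : NEList S) : prod (append l m) = prod l * prod m := by
  induction l with
  | single s => rfl
  | cons s l ih => simp only [append, prod, ih, _root_.mul_assoc]

theorem prod_flatten [Semigroup S] (L : NEList (NEList S)) :
    prod (flatten L) = prod (map prod L) := by
  induction L with
  | single l => rfl
  | cons l L ih => simp only [flatten, map, prod, prod_append, ih]

/-- A semigroup as an algebra over the non-empty list monad. -/
def semigroupAlgebra (S : Type u) [Semigroup S] : monad.{u}.Algebra where
  A := S
  a := ↾prod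
  unit := rfl
  assoc := by ext L; exact prod_flatten L

theorem algebraMul_semigroupAlgebra [Semigroup S] (s t : S) :
    algebraMul (semigroupAlgebra S) s t = s * t :=
  rfl

theorem apply_prod_eq_map_prod_theta [Mul S] {p : S → NEList S} (head_p : ∀ s, head (p s) = s)
    (p_mul : ∀ s t, p (s * t) = append (map (· * t) (p s)) (p t)) (l : NEList S) :
    p (prod l) = map prod (theta (map p l)) := by
  induction l with
  | single s => simp only [prod, map, theta, map_map, map_id']
  | cons s l ih => simp only [prod, map, theta, map_append, map_map, head_p, map_id', p_mul, ih]

/-- The entwined coalgebra on a semigroup `S` given by a structure map `p : S → L⁺S`. Here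
`p_mul` says, for lists of length two, that `p` is a morphism to the lifted algebra on `L⁺S`. -/
def semigroupCoalgebra [Semigroup S] (p : S → NEList S) (head_p : ∀ s, head (p s) = s)
    (map_p_p : ∀ s, map p (p s) = tails (p s))
    (p_mul : ∀ s t, p (s * t) = append (map (· * t) (p s)) (p t)) :
    bimonad.{u}.EntwinedCoalgebra where
  A := semigroupAlgebra S
  a :=
    { f := ↾p
      h := by ext l; exact (apply_prod_eq_map_prod_theta head_p p_mul l).symm }
  counit := by ext s; exact head_p s
  coassoc := by ext s; exact (map_p_p s).symm

end Semigroup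

end NEList

/-- The set `ℕ × α`, thought of as a family of infinite towers indexed by `α`: `up` is applied `n`
times to `root a` to obtain the element at height `n` of the tower of `a`. -/
inductive Tower (α : Type u) : Type u
  | root (a : α) : Tower α
  | up (s : Tower α) : Tower α

namespace Tower

open NEList

variable {α : Type u}

/-- The multiplication `(m, a) * (n, b) = (m + n + 1, b)` of towers. -/
def mul : Tower α → Tower α → Tower α
  | root _, t => up t
  | up s, t => up (mul s t)

instance : Mul (Tower α) := ⟨mul⟩

theorem root_mul (a : α) (t : Tower α) : root a * t = up t := rfl

theorem up_mul (s t : Tower α) : up s * t = up (s * t) := rfl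

instance : Semigroup (Tower α) where
  mul_assoc s t r := by
    induction s with
    | root a => rfl
    | up s ih => simp only [up_mul, ih]

/-- The path from an element down to the root of its tower. -/
def path : Tower α → NEList (Tower α)
  | root a => single (root a)
  | up s => cons (up s) (path s)

theorem head_path (s : Tower α) : head (path s) = s := by
  cases s <;> rfl

theorem map_path_path (s : Tower α) : NEList.map path (path s) = tails (path s) := by
  induction s with
  | root a => rfl
  | up s ih => simp only [path, NEList.map, tails, ih]

theorem path_mul (s t : Tower α) :
    path (s * t) = append (NEList.map (· * t) (path s)) (path t) := by
  induction s with
  | root a => rfl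
  | up s ih => simp only [up_mul, path, NEList.map, append, ih]

/-- The semigroup of towers over `α` as an entwined coalgebra, with `path` as structure map. -/
def coalgebra (α : Type u) : NEList.bimonad.{u}.EntwinedCoalgebra :=
  semigroupCoalgebra (path (α := α)) head_path map_path_path path_mul

theorem coalgebra_notMem_essImage_comparison (α : Type u) [Nontrivial α] :
    ¬ NEList.bimonad.comparison.essImage (coalgebra α) := by
  intro h
  obtain ⟨a, b, hab⟩ := exists_pair_ne α
  have mul_eq_mul : root a * root a = root b * root a := by rw [root_mul, root_mul]
  rw [← algebraMul_semigroupAlgebra, ← algebraMul_semigroupAlgebra] at mul_eq_mul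
  exact hab (root.inj (algebraMul_right_cancel_of_mem_essImage h mul_eq_mul))

end Tower

theorem NEList.not_essSurj_comparison : ¬ NEList.bimonad.{u}.comparison.EssSurj := fun h =>
  Tower.coalgebra_notMem_essImage_comparison (ULift.{u} Bool) (h.mem_essImage _)

theorem mainTheorem10 :
    ¬ (NEList.bimonad.{u}.comparison :
        Type u ⥤ NEList.bimonad.{u}.EntwinedCoalgebra).IsEquivalence ∧
      ¬ NEList.bimonad.{u}.ConjugateClassificationApplies := by
  have not_isEquivalence : ¬ NEList.bimonad.{u}.comparison.IsEquivalence := fun h =>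
    NEList.not_essSurj_comparison h.essSurj
  exact ⟨not_isEquivalence, fun h => not_isEquivalence h.2⟩
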